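/- Let $K$ be a field, let $n,d\ge 1$ and $t\ge 0$ be integers, and let $S=K[x_1,\dots,x_n]$ with its standard grading. Let $M_{n,d,t}$ be the set of monomials $x_{i_1}x_{i_2}\cdots x_{i_d}$ of $S$ with $1\le i_1\le\dots\le i_d\le n$ and $i_{j+1}-i_j\ge t$ for $j=1,\dots,d-1$ (the $t$-spread monomials of degree $d$). Order $M_{n,d,t}$ by $x_{i_1}\cdots x_{i_d}>x_{j_1}\cdots x_{j_d}$ if, for some $s$, $i_1=j_1,\dots,i_{s-1}=j_{s-1}$ and $i_s<j_s$. For $u,v\in M_{n,d,t}$ with $u\ge v$ put $$\mathcal L_t(u,v)=\{\omega\in M_{n,d,t}: u\ge\omega\ge v\},\quad \mathcal L_t^i(v)=\{\omega\in M_{n,d,t}:\omega\ge v\},\quad \mathcal L_t^f(u)=\{\omega\in M_{n,d,t}:\omega\le u\}.$$ For a monomial $\omega\neq 1$ let $\min(\omega)$ and $\max(\omega)$ be the smallest and the largest index $k$ such that $x_k$ divides $\omega$. For a homogeneous ideal $I$ of $S$ let $\beta_{i,j}(I)=\dim_K\operatorname{Tor}^S_i(K,I)_j$ be its graded Betti numbers,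 i.e. the number of summands $S(-j)$ in the $i$-th module of the minimal graded free resolution of $I$. Let $u,v\in M_{n,d,t}$ with $u\ge v$ be such that $I=(\mathcal L_t(u,v))$ is a completely $t$-spread lexsegment ideal, that is, $I=(\mathcal L_t^i(v))\cap(\mathcal L_t^f(u))$. Suppose that $I$ has a linear resolution, that is, $\beta_{i,j}(I)=0$ for all $i>0$ and all $j\ne d+i$. Then, for all $i\ge 0$, $$\beta_{i,i+d}(I)=\sum_{\omega\in\mathcal L_t^f(u)}\binom{n-\min(\omega)-(d-1)t}{i}-\sum_{\substack{\omega\in\mathcal L_t^f(v)\\ \omega\ne v}}\binom{\max(\omega)-(d-1)t-1}{i}.$$ -/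

import Mathlib

namespace TSpread

open MvPolynomial

noncomputable section

/-! ### Minimal graded free resolutions and graded Betti numbers -/

section Betti

variable {K : Type*} [Field K] {n : ℕ}

/-- `v` is a homogeneous element of degree `m` of the graded free module `⨁ₖ S(-deg k)`,
where `S = K[x₁, …, xₙ]`: every monomial of its `k`-th coordinate has degree `m - deg k`. -/
def IsHomogeneousVec {r : ℕ} (deg : Fin r → ℕ) (m : ℕ)
    (v : Fin r → MvPolynomial (Fin n) K) : Prop :=
  ∀ k, ∀ s ∈ (v k).support, s.degree + deg k = m

/-- A minimal graded free resolution `⋯ → F₁ → F₀ → I → 0` of the ideal `I` of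
`S = K[x₁, …, xₙ]` with `Fᵢ = ⨁ₖ S(-deg i k)` of finite rank `rank i`, all maps being homogeneous
of degree zero. -/
structure MinimalGradedFreeResolution (I : Ideal (MvPolynomial (Fin n) K)) where
  /-- the rank of `Fᵢ` -/
  rank : ℕ → ℕ
  /-- the degrees of the basis elements of `Fᵢ` -/
  deg : (i : ℕ) → Fin (rank i) → ℕ
  /-- the augmentation `F₀ → I ⊆ S` -/
  aug : (Fin (rank 0) → MvPolynomial (Fin n) K) →ₗ[MvPolynomial (Fin n) K]
    MvPolynomial (Fin n) K
  /-- the differential `Fᵢ₊₁ → Fᵢ` -/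
  diff : (i : ℕ) → (Fin (rank (i + 1)) → MvPolynomial (Fin n) K) →ₗ[MvPolynomial (Fin n) K]
    (Fin (rank i) → MvPolynomial (Fin n) K)
  aug_homogeneous : ∀ m v, IsHomogeneousVec (deg 0) m v → (aug v).IsHomogeneous m
  diff_homogeneous : ∀ i m v, IsHomogeneousVec (deg (i + 1)) m v →
    IsHomogeneousVec (deg i) m (diff i v)
  range_aug : LinearMap.range aug = I
  exact_zero : LinearMap.range (diff 0) = LinearMap.ker aug
  exact_succ : ∀ i, LinearMap.range (diff (i + 1)) = LinearMap.ker (diff i)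
  /-- minimality: the image of `Fᵢ₊₁` lies in `(x₁, …, xₙ) Fᵢ` -/
  minimal : ∀ i v k, diff i v k ∈ Ideal.span (Set.range (X : Fin n → MvPolynomial (Fin n) K))

/-- The homogeneous component of degree `m` in `⨁ₖ S(-deg k)`. -/
def vecComponent {r : ℕ} (deg : Fin r → ℕ) (m : ℕ)
    (v : Fin r → MvPolynomial (Fin n) K) : Fin r → MvPolynomial (Fin n) K :=
  fun k => if deg k ≤ m then homogeneousComponent (m - deg k) (v k) else 0

lemma coeff_vecComponent {r : ℕ} (deg : Fin r → ℕ) (m : ℕ)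
    (v : Fin r → MvPolynomial (Fin n) K) (k : Fin r) (s : Fin n →₀ ℕ) :
    coeff s (vecComponent deg m v k) = if s.degree + deg k = m then coeff s (v k) else 0 := by
  unfold vecComponent
  split_ifs with h1 h2 h2
  · rw [coeff_homogeneousComponent, if_pos (by omega)]
  · rw [coeff_homogeneousComponent, if_neg (by omega)]
  · omega
  · simp

lemma isHomogeneousVec_iff {r : ℕ} (deg : Fin r → ℕ) (m : ℕ)
    (v : Fin r → MvPolynomial (Fin n) K) :
    IsHomogeneousVec deg m v ↔ vecComponent deg m v = v := by
  constructor
  · intro h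
    funext k
    ext s
    rw [coeff_vecComponent]
    split_ifs with hs
    · rfl
    · by_contra hc
      exact hs (h k s (mem_support_iff.mpr (fun h0 => hc h0.symm)))
  · intro h k s hs
    by_contra hc
    rw [← h, mem_support_iff, coeff_vecComponent, if_neg hc] at hs
    exact hs rfl

lemma isHomogeneousVec_vecComponent {r : ℕ} (deg : Fin r → ℕ) (m : ℕ)
    (v : Fin r → MvPolynomial (Fin n) K) : IsHomogeneousVec deg m (vecComponent deg m v) := by
  intro k s hs
  by_contra hc
  rw [mem_support_iff, coeff_vecComponent, if_neg hc] at hs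
  exact hs rfl

lemma vecComponent_add {r : ℕ} (deg : Fin r → ℕ) (m : ℕ)
    (v w : Fin r → MvPolynomial (Fin n) K) :
    vecComponent deg m (v + w) = vecComponent deg m v + vecComponent deg m w := by
  funext k
  ext s
  simp only [Pi.add_apply, coeff_add, coeff_vecComponent]
  split_ifs <;> simp

lemma vecComponent_sum {r : ℕ} (deg : Fin r → ℕ) (m : ℕ) {ι : Type*} (t : Finset ι)
    (f : ι → Fin r → MvPolynomial (Fin n) K) :
    vecComponent deg m (∑ i ∈ t, f i) = ∑ i ∈ t, vecComponent deg m (f i) := by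
  classical
  induction t using Finset.induction_on with
  | empty =>
    funext k
    ext s
    simp [coeff_vecComponent]
  | insert a t ha ih => rw [Finset.sum_insert ha, Finset.sum_insert ha, vecComponent_add, ih]

/-- The component of `c • g` for a homogeneous vector `g`. -/
lemma vecComponent_smul {r : ℕ} (deg : Fin r → ℕ) (m e : ℕ) (c : MvPolynomial (Fin n) K)
    (g : Fin r → MvPolynomial (Fin n) K) (hg : IsHomogeneousVec deg e g) :
    vecComponent deg m (c • g) =
      (if e ≤ m then homogeneousComponent (m - e) c else 0) • g := by
  classical
  funext k
  ext s
  rw [coeff_vecComponent]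
  simp only [Pi.smul_apply, smul_eq_mul, coeff_mul]
  have hite : ∀ (P : Prop) [Decidable P] (f : (Fin n →₀ ℕ) × (Fin n →₀ ℕ) → K)
      (A : Finset ((Fin n →₀ ℕ) × (Fin n →₀ ℕ))),
      (if P then ∑ x ∈ A, f x else 0) = ∑ x ∈ A, if P then f x else 0 := by
    intro P _ f A
    split_ifs <;> simp
  rw [hite]
  refine Finset.sum_congr rfl ?_
  rintro ⟨a, b⟩ hab
  rw [Finset.HasAntidiagonal.mem_antidiagonal] at hab
  simp only at hab ⊢
  by_cases hb : coeff b (g k) = 0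
  · simp [hb]
  have hdeg := hg k b (mem_support_iff.mpr hb)
  have hs : s.degree = a.degree + b.degree := by rw [← hab]; simp [map_add]
  split_ifs with h1 h2 h2
  · rw [coeff_homogeneousComponent, if_pos (by omega)]
  · omega
  · rw [coeff_homogeneousComponent, if_neg (by omega), zero_mul]
  · simp

lemma vec_eq_sum_components {r : ℕ} (deg : Fin r → ℕ) (v : Fin r → MvPolynomial (Fin n) K) :
    ∃ M : ℕ, v = ∑ m ∈ Finset.range M, vecComponent deg m v := by
  classical
  refine ⟨(Finset.univ.sup fun k => (v k).totalDegree + deg k) + 1, ?_⟩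
  funext k
  ext s
  rw [Finset.sum_apply, coeff_sum]
  simp only [coeff_vecComponent]
  rw [Finset.sum_ite_eq]
  split_ifs with h
  · rfl
  · by_contra hc
    have h1 : s.degree ≤ (v k).totalDegree := le_totalDegree (mem_support_iff.mpr hc)
    have h2 : (v k).totalDegree + deg k ≤ Finset.univ.sup fun k => (v k).totalDegree + deg k :=
      Finset.le_sup (f := fun k => (v k).totalDegree + deg k) (Finset.mem_univ k)
    simp only [Finset.mem_range] at h
    omega

/-- A submodule of `⨁ₖ S(-deg k)` that contains the homogeneous components of its elements. -/
def IsGradedSubmodule {r : ℕ} (deg : Fin r → ℕ)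
    (N : Submodule (MvPolynomial (Fin n) K) (Fin r → MvPolynomial (Fin n) K)) : Prop :=
  ∀ v ∈ N, ∀ m, vecComponent deg m v ∈ N

/-- A graded submodule has a minimal system of homogeneous generators. -/
lemma exists_minimal_generators {r : ℕ} (deg : Fin r → ℕ)
    (N : Submodule (MvPolynomial (Fin n) K) (Fin r → MvPolynomial (Fin n) K))
    (hN : IsGradedSubmodule deg N) :
    ∃ (s : ℕ) (e : Fin s → ℕ) (g : Fin s → Fin r → MvPolynomial (Fin n) K),
      (∀ k, IsHomogeneousVec deg (e k) (g k)) ∧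
      Submodule.span (MvPolynomial (Fin n) K) (Set.range g) = N ∧
      ∀ c : Fin s → MvPolynomial (Fin n) K, ∑ k, c k • g k = 0 → ∀ k, coeff 0 (c k) = 0 := by
  classical
  let P : ℕ → Prop := fun s => ∃ (e : Fin s → ℕ) (g : Fin s → Fin r → MvPolynomial (Fin n) K),
      (∀ k, IsHomogeneousVec deg (e k) (g k)) ∧
      Submodule.span (MvPolynomial (Fin n) K) (Set.range g) = N
  have hP : ∃ s, P s := by
    obtain ⟨G, hG⟩ := IsNoetherian.noetherian N
    choose M hM using vec_eq_sum_components (K := K) (n := n) deg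
    let T : Finset ((Fin r → MvPolynomial (Fin n) K) × ℕ) :=
      G.biUnion fun v => (Finset.range (M v)).image fun m => (v, m)
    let eqv := T.equivFin.symm
    refine ⟨T.card, fun k => (eqv k).1.2, fun k => vecComponent deg (eqv k).1.2 (eqv k).1.1,
      fun k => isHomogeneousVec_vecComponent _ _ _, le_antisymm ?_ ?_⟩
    · rw [Submodule.span_le]
      rintro _ ⟨k, rfl⟩
      apply hN
      have hk := (eqv k).2
      simp only [T, Finset.mem_biUnion, Finset.mem_image] at hk
      obtain ⟨v, hv, m, -, hvm⟩ := hk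
      rw [← hvm, ← hG]
      exact Submodule.subset_span hv
    · rw [← hG, Submodule.span_le]
      intro v hv
      have hv' : v ∈ G := hv
      rw [SetLike.mem_coe, hM v]
      refine Submodule.sum_mem _ fun m hm => Submodule.subset_span ?_
      have hT : (v, m) ∈ T := Finset.mem_biUnion.mpr ⟨v, hv', Finset.mem_image.mpr ⟨m, hm, rfl⟩⟩
      exact ⟨eqv.symm ⟨(v, m), hT⟩, by simp⟩
  obtain ⟨e, g, hhom, hspan⟩ := Nat.find_spec hP
  refine ⟨Nat.find hP, e, g, hhom, hspan, ?_⟩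
  have hmin : ∀ s, P s → Nat.find hP ≤ s := fun s hs => Nat.find_min' hP hs
  generalize Nat.find hP = s at e g hhom hspan hmin
  intro c hc k₀
  by_contra hk
  obtain _ | s := s
  · exact k₀.elim0
  have hcomp : ∑ k, (if e k ≤ e k₀ then homogeneousComponent (e k₀ - e k) (c k) else 0) • g k
      = 0 := by
    have h1 := congrArg (vecComponent deg (e k₀)) hc
    rw [vecComponent_sum] at h1
    simp only [vecComponent_smul deg (e k₀) (e _) _ _ (hhom _)] at h1
    rw [h1]
    funext k
    ext s
    simp [coeff_vecComponent]
  rw [Fin.sum_univ_succAbove _ k₀] at hcomp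
  simp only [le_refl, if_true, Nat.sub_self, homogeneousComponent_zero] at hcomp
  let N' := Submodule.span (MvPolynomial (Fin n) K) (Set.range fun k => g (k₀.succAbove k))
  have hmem : g k₀ ∈ N' := by
    have h2 : (C (coeff 0 (c k₀)) : MvPolynomial (Fin n) K) • g k₀ ∈ N' := by
      rw [eq_neg_of_add_eq_zero_left hcomp]
      exact N'.neg_mem (N'.sum_mem fun k _ => N'.smul_mem _ (Submodule.subset_span ⟨k, rfl⟩))
    have h3 := N'.smul_mem (C (coeff 0 (c k₀))⁻¹) h2
    rwa [smul_smul, ← C_mul, inv_mul_cancel₀ hk, C_1, one_smul] at h3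
  have hPs : P s := by
    refine ⟨fun k => e (k₀.succAbove k), fun k => g (k₀.succAbove k), fun k => hhom _,
      le_antisymm ?_ ?_⟩
    · rw [← hspan, Submodule.span_le]
      rintro _ ⟨k, rfl⟩
      exact Submodule.subset_span ⟨_, rfl⟩
    · rw [← hspan, Submodule.span_le]
      rintro _ ⟨k, rfl⟩
      rcases Fin.eq_self_or_eq_succAbove k₀ k with rfl | ⟨j, rfl⟩
      · exact hmem
      · exact Submodule.subset_span ⟨j, rfl⟩
  have := hmin s hPs
  omega

/-- A graded submodule of a graded free module of finite rank, as a step of the construction of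
a resolution. -/
structure GradedSub (K : Type*) [Field K] (n : ℕ) where
  rank : ℕ
  deg : Fin rank → ℕ
  sub : Submodule (MvPolynomial (Fin n) K) (Fin rank → MvPolynomial (Fin n) K)
  graded : IsGradedSubmodule deg sub

lemma GradedSub.exists_cover (A : GradedSub K n) :
    ∃ (B : GradedSub K n) (f : (Fin B.rank → MvPolynomial (Fin n) K) →ₗ[MvPolynomial (Fin n) K]
        (Fin A.rank → MvPolynomial (Fin n) K)),
      (∀ m v, IsHomogeneousVec B.deg m v → IsHomogeneousVec A.deg m (f v)) ∧
      LinearMap.range f = A.sub ∧ LinearMap.ker f = B.sub ∧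
      ∀ v ∈ B.sub, ∀ k, coeff 0 (v k) = 0 := by
  classical
  obtain ⟨s, e, g, hhom, hspan, hmin⟩ := exists_minimal_generators A.deg A.sub A.graded
  let f := Fintype.linearCombination (MvPolynomial (Fin n) K) g
  have hf : ∀ m v, vecComponent A.deg m (f v) = f (vecComponent e m v) := by
    intro m v
    simp only [f, Fintype.linearCombination_apply]
    rw [vecComponent_sum]
    simp only [vecComponent_smul A.deg m (e _) _ _ (hhom _)]
    rfl
  refine ⟨⟨s, e, LinearMap.ker f, ?_⟩, f, ?_, ?_, rfl, ?_⟩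
  · intro v hv m
    rw [LinearMap.mem_ker, ← hf, LinearMap.mem_ker.mp hv]
    funext k
    ext s
    simp [coeff_vecComponent]
  · intro m v hv
    rw [isHomogeneousVec_iff] at hv ⊢
    rw [hf, hv]
  · rw [Fintype.range_linearCombination, hspan]
  · intro v hv
    exact hmin v (by simpa [f, Fintype.linearCombination_apply] using hv)

/-- Existence of minimal graded free resolutions of homogeneous ideals. -/
theorem exists_minimalGradedFreeResolution (I : Ideal (MvPolynomial (Fin n) K))
    (hI : ∀ p ∈ I, ∀ m, homogeneousComponent m p ∈ I) :
    Nonempty (MinimalGradedFreeResolution I) := by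
  classical
  choose B f hf hrange hker hmin using GradedSub.exists_cover (K := K) (n := n)
  let ev := LinearMap.proj (R := MvPolynomial (Fin n) K)
    (φ := fun _ : Fin 1 => MvPolynomial (Fin n) K) 0
  let A₀ : GradedSub K n := ⟨1, fun _ => 0, Submodule.comap ev I, fun v hv m => by
    simpa [ev, vecComponent] using hI _ hv m⟩
  let st : ℕ → GradedSub K n := fun i => Nat.rec A₀ (fun _ A => B A) i
  have hev : Function.Injective ev := by
    intro v w h
    funext k
    rw [Subsingleton.elim k 0]
    exact h
  refine ⟨⟨fun i => (st (i + 1)).rank, fun i => (st (i + 1)).deg, ev ∘ₗ f (st 0),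
    fun i => f (st (i + 1)), ?_, fun i => hf (st (i + 1)), ?_, ?_, ?_, ?_⟩⟩
  · intro m v hv s hs
    have := hf (st 0) m v hv 0 s (mem_support_iff.mpr hs)
    rw [← this]
    simp only [st, A₀]
    rw [Finsupp.degree_eq_weight_one]
    rfl
  · rw [LinearMap.range_comp, hrange]
    apply Submodule.map_comap_eq_of_surjective
    intro p
    exact ⟨fun _ => p, rfl⟩
  · rw [hrange, LinearMap.ker_comp_of_ker_eq_bot _ (LinearMap.ker_eq_bot.mpr hev), hker]
  · intro i
    rw [hrange, hker]
  · intro i v k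
    have h1 : f (st (i + 1)) v ∈ (st (i + 1)).sub := by
      rw [← hrange]
      exact ⟨v, rfl⟩
    have h2 := hmin (st i) _ h1 k
    rw [← Set.image_univ, mem_ideal_span_X_image]
    intro s hs
    have hs0 : s ≠ 0 := by
      rintro rfl
      exact mem_support_iff.mp hs h2
    obtain ⟨j, hj⟩ := Finsupp.ne_iff.mp hs0
    exact ⟨j, Set.mem_univ _, hj⟩

open Classical in
/-- The graded Betti number `β_{i,j}(I)`: the number of summands `S(-j)` in the `i`-th module of the
minimal graded free resolution of `I`. Such a resolution exists whenever `I` is homogeneous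
(`exists_minimalGradedFreeResolution`), and it is unique up to isomorphism. -/
def gradedBetti (I : Ideal (MvPolynomial (Fin n) K)) (i j : ℕ) : ℕ :=
  if h : Nonempty (MinimalGradedFreeResolution I) then
    (Finset.univ.filter fun k => h.some.deg i k = j).card
  else 0

/-- `I` has a `d`-linear resolution. -/
def HasLinearResolution (d : ℕ) (I : Ideal (MvPolynomial (Fin n) K)) : Prop :=
  ∀ i j, 0 < i → j ≠ d + i → gradedBetti I i j = 0

end Betti

/-! ### `t`-spread monomials and lexsegments

A monomial `x_{i₁} ⋯ x_{i_d}` with `i₁ ≤ ⋯ ≤ i_d` is encoded by its sequence of indices, a map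
`Fin d → Fin n`; the indices `1, …, n` of the variables are shifted to `0, …, n - 1`. -/

section Lexsegments

variable {n d : ℕ}

open Classical in
/-- The set `M_{n,d,t}` of the `t`-spread monomials of degree `d` in `n` variables:
`i_{j+1} - i_j ≥ t` for `j = 1, …, d - 1` (and in particular `i_j ≤ i_{j+1}`). -/
def spreadMonomials (n d t : ℕ) : Finset (Fin d → Fin n) :=
  Finset.univ.filter fun a => ∀ j k : Fin d, (j : ℕ) + 1 = k → (a j : ℕ) + t ≤ a k

/-- `u >ₛₗₑₓ v`: at the first place where the index sequences differ, `u` has the smaller index. -/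
def SlexGT (u v : Fin d → Fin n) : Prop :=
  ∃ s, (∀ j < s, u j = v j) ∧ u s < v s

/-- `u ≥ₛₗₑₓ v`. -/
def SlexGE (u v : Fin d → Fin n) : Prop :=
  u = v ∨ SlexGT u v

open Classical in
/-- The `t`-spread lexsegment `L_t(u, v)`. -/
def lexSegment (t : ℕ) (u v : Fin d → Fin n) : Finset (Fin d → Fin n) :=
  (spreadMonomials n d t).filter fun w => SlexGE u w ∧ SlexGE w v

open Classical in
/-- The initial `t`-spread lexsegment `L_t^i(v)`. -/
def initialLexSegment (t : ℕ) (v : Fin d → Fin n) : Finset (Fin d → Fin n) :=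
  (spreadMonomials n d t).filter fun w => SlexGE w v

open Classical in
/-- The final `t`-spread lexsegment `L_t^f(u)`. -/
def finalLexSegment (t : ℕ) (u : Fin d → Fin n) : Finset (Fin d → Fin n) :=
  (spreadMonomials n d t).filter fun w => SlexGE u w

/-- The smallest index (counted from `1`) of a variable dividing the monomial; `0` for `1`. -/
def minIndex (a : Fin d → Fin n) : ℕ :=
  sInf (Set.range fun j => (a j : ℕ) + 1)

/-- The largest index (counted from `1`) of a variable dividing the monomial; `0` for `1`. -/
def maxIndex (a : Fin d → Fin n) : ℕ :=
  Finset.univ.sup fun j => (a j : ℕ) + 1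

variable (K : Type*) [Field K]

/-- The ideal of `K[x₁, …, xₙ]` generated by a set of monomials of degree `d`. -/
def monomialIdeal (A : Finset (Fin d → Fin n)) : Ideal (MvPolynomial (Fin n) K) :=
  Ideal.span ((fun a => ∏ j, (X (a j) : MvPolynomial (Fin n) K)) '' (A : Set (Fin d → Fin n)))

/-- The ideal `(L_t(u, v))` is completely `t`-spread lexsegment:
`(L_t(u, v)) = (L_t^i(v)) ∩ (L_t^f(u))`. -/
def IsCompletelyLexsegment (t : ℕ) (u v : Fin d → Fin n) : Prop :=
  monomialIdeal K (lexSegment t u v) =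
    monomialIdeal K (initialLexSegment t v) ⊓ monomialIdeal K (finalLexSegment t u)

end Lexsegments


end

end TSpread

/-! When the resolution of I is linear, its i-th free module is generated in degree d + i alone.
Hence nothing cancels in the alternating sum of Hilbert series, and the Betti numbers are, up to
sign, the coefficients of the Hilbert series of I times (1 - X)^n (`coeff_hilbertSeries_of_linear`).
It remains to compute that series.

By complete lexsegmentness I is the intersection of J = (L^i(v)) and F = (L^f(u)), and since u ≥ v
the sum J + F is generated by all t-spread monomials of degree d. Counting monomials gives H(I) =
H(J) + H(F) - H(J + F).

The generators of J and of J + F are closed under componentwise decrease of index sequences. For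
such a set every monomial of the ideal has a componentwise smallest t-spread divisor a of degree d.
The monomials with a given a are a times an arbitrary monomial in the variables outside `gaps t a`,
a set of max(a) - (d-1)t - 1 indices (`card_gaps`). This yields `hilbertSeries_of_isLowerSet`. The
generators of F are closed under componentwise increase, and reversing the variables turns this into
the previous case, with n - min(a) - (d-1)t in place of the former exponent.

The sum for J cancels against the terms of J + F with a ≥ v, which leaves the terms a < v with a
minus sign. -/

namespace TSpread

open MvPolynomial

/-! ### Smallest t-spread divisors and gaps -/

section Combinatorics

variable {n d : ℕ}

/-- The exponent vector of the monomial with index sequence `a`. -/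
noncomputable def expo (a : Fin d → Fin n) : Fin n →₀ ℕ :=
  ∑ j, Finsupp.single (a j) 1

lemma expo_apply (a : Fin d → Fin n) (l : Fin n) :
    expo a l = (Finset.univ.filter fun j => a j = l).card := by
  rw [Finset.card_filter, expo, Finsupp.finsetSum_apply]
  simp only [Finsupp.single_apply]

lemma sum_expo (a : Fin d → Fin n) : ∑ l, expo a l = d := by
  simp only [expo, Finsupp.finsetSum_apply]
  rw [Finset.sum_comm]
  simp [Finsupp.single_apply]

/-- The indices `l` with `a_{j-1} + t ≤ l < a_j` for some `j`. -/
def gaps (t : ℕ) (a : Fin d → Fin n) : Finset (Fin n) :=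
  Finset.univ.filter fun l => ∃ j, l < a j ∧ ∀ k : Fin d, (k : ℕ) + 1 = j → (a k : ℕ) + t ≤ l

lemma mem_gaps {t : ℕ} {a : Fin d → Fin n} {l : Fin n} :
    l ∈ gaps t a ↔ ∃ j, l < a j ∧ ∀ k : Fin d, (k : ℕ) + 1 = j → (a k : ℕ) + t ≤ l := by
  simp [gaps]

lemma mem_spreadMonomials {t : ℕ} {a : Fin d → Fin n} :
    a ∈ spreadMonomials n d t ↔ ∀ j k : Fin d, (j : ℕ) + 1 = k → (a j : ℕ) + t ≤ a k := by
  simp [spreadMonomials]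

lemma monotone_of_mem_spreadMonomials {t : ℕ} {a : Fin d → Fin n}
    (ha : a ∈ spreadMonomials n d t) : Monotone a := by
  rw [mem_spreadMonomials] at ha
  obtain _ | e := d
  · exact fun j => j.elim0
  · refine Fin.monotone_iff_le_succ.mpr fun j => ?_
    have := ha j.castSucc j.succ (by simp)
    exact Fin.le_def.mpr (by omega)

/-- `a` is the componentwise smallest `t`-spread divisor of the monomial with exponents `s`. -/
def IsCanonical (t : ℕ) (a : Fin d → Fin n) (s : Fin n →₀ ℕ) : Prop :=
  expo a ≤ s ∧ ∀ l ∈ gaps t a, s l = expo a l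

/-- At a first place j with b j < a j, the index b j falls into a gap of a, where s has no more than
the exponent of a. But b uses that index at least once more than a does. Consequently canonical
divisors are unique. -/
lemma IsCanonical.le_of_expo_le {t : ℕ} {a b : Fin d → Fin n} {s : Fin n →₀ ℕ}
    (ha : IsCanonical t a s) (has : a ∈ spreadMonomials n d t) (hbs : b ∈ spreadMonomials n d t)
    (hb : expo b ≤ s) : ∀ j, a j ≤ b j := by
  have hma := monotone_of_mem_spreadMonomials has
  have hmb := monotone_of_mem_spreadMonomials hbs
  rw [mem_spreadMonomials] at hbs
  intro j
  induction j using WellFoundedLT.induction with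
  | ind j ih =>
  by_contra hlt
  push Not at hlt
  have hgap : b j ∈ gaps t a := by
    refine mem_gaps.mpr ⟨j, hlt, fun k hk => ?_⟩
    have h1 := hbs k j hk
    have h2 := Fin.le_def.mp (ih k (Fin.lt_def.mpr (by omega)))
    omega
  have h1 := hb (b j)
  rw [ha.2 _ hgap, expo_apply, expo_apply] at h1
  refine absurd (Finset.card_lt_card ?_) (not_lt.mpr h1)
  -- Any k with a k = b j precedes j, so a k ≤ b k ≤ b j = a k and b takes the same value at k; the
  -- place j is an extra occurrence.
  refine Finset.ssubset_iff.mpr ⟨j, by simpa using hlt.ne', ?_⟩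
  intro k hk
  rw [Finset.mem_insert] at hk
  rcases hk with rfl | hk
  · simp
  · simp only [Finset.mem_filter, Finset.mem_univ, true_and] at hk ⊢
    have hkj : k < j := by
      by_contra hc
      have := hma (not_lt.mp hc)
      rw [hk] at this
      exact absurd hlt (not_lt.mpr this)
    exact le_antisymm (hmb hkj.le) (hk ▸ ih k hkj)

/-- A t-spread divisor with the smallest sum of indices is canonical: if s had exponent to spare at
a gap l below a j, replacing a j by l would give a t-spread divisor with a smaller sum. -/
lemma exists_isCanonical {t : ℕ} {b : Fin d → Fin n} {s : Fin n →₀ ℕ}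
    (hbs : b ∈ spreadMonomials n d t) (hb : expo b ≤ s) :
    ∃ a ∈ spreadMonomials n d t, IsCanonical t a s := by
  classical
  obtain ⟨a, ha, hmin⟩ := ((spreadMonomials n d t).filter fun a => expo a ≤ s).exists_min_image
    (fun a => ∑ j, (a j : ℕ)) ⟨b, by simp [hbs, hb]⟩
  rw [Finset.mem_filter] at ha
  refine ⟨a, ha.1, ha.2, ?_⟩
  intro l hl
  by_contra hne
  have hlt : expo a l < s l := lt_of_le_of_ne (ha.2 l) (Ne.symm hne)
  obtain ⟨j, hj, hprev⟩ := mem_gaps.mp hl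
  have hlow : ∀ k, Function.update a j l k ≤ a k := by
    intro k
    rcases eq_or_ne k j with rfl | hk
    · simpa using hj.le
    · simp [hk]
  have hmem : Function.update a j l ∈
      (spreadMonomials n d t).filter fun a => expo a ≤ s := by
    rw [Finset.mem_filter]
    constructor
    · rw [mem_spreadMonomials]
      intro k k' hkk
      have hkne : k ≠ k' := by rintro rfl; omega
      have h1 := mem_spreadMonomials.mp ha.1 k k' hkk
      rcases eq_or_ne k' j with rfl | hk'
      · rw [Function.update_self, Function.update_of_ne hkne]
        exact hprev k hkk
      · rw [Function.update_of_ne hk']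
        have := Fin.le_def.mp (hlow k)
        omega
    · intro x
      rcases eq_or_ne x l with rfl | hx
      · refine le_trans ?_ (Nat.succ_le_of_lt hlt)
        rw [expo_apply, expo_apply]
        -- Only the changed place j can add an occurrence of this index, so the exponent grows by at
        -- most one, for which `hlt` leaves room.
        refine (Finset.card_le_card (t := insert j (Finset.univ.filter fun k => a k = x)) ?_).trans
          (Finset.card_insert_le _ _)
        intro k hk
        rcases eq_or_ne k j with rfl | hkj
        · simp
        · simpa [hkj] using hk
      · refine le_trans ?_ (ha.2 x)
        rw [expo_apply, expo_apply]
        refine Finset.card_le_card fun k hk => ?_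
        rcases eq_or_ne k j with rfl | hkj
        · simp [hx.symm] at hk
        · simpa [hkj] using hk
  refine absurd (hmin _ hmem) (not_le.mpr ?_)
  exact Finset.sum_lt_sum (fun k _ => Fin.le_def.mp (hlow k))
    ⟨j, Finset.mem_univ _, by simpa using hj⟩

/-- The gaps are the disjoint intervals [0, a 0) and [a i + t, a (i+1)), and their lengths
telescope, each step losing t. -/
lemma card_gaps {e t : ℕ} {a : Fin (e + 1) → Fin n} (ha : a ∈ spreadMonomials n (e + 1) t) :
    (gaps t a).card + e * t = a (Fin.last e) := by
  classical
  have hm := monotone_of_mem_spreadMonomials ha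
  rw [mem_spreadMonomials] at ha
  have key : ∀ i (hi : i < e + 1), (Finset.univ.filter fun l : Fin n => ∃ j : Fin (e + 1),
      (j : ℕ) ≤ i ∧ l < a j ∧ ∀ k : Fin (e + 1), (k : ℕ) + 1 = j → (a k : ℕ) + t ≤ l).card
        + i * t = a ⟨i, hi⟩ := by
    intro i
    induction i with
    | zero =>
      intro hi
      have : (Finset.univ.filter fun l : Fin n => ∃ j : Fin (e + 1),
          (j : ℕ) ≤ 0 ∧ l < a j ∧ ∀ k : Fin (e + 1), (k : ℕ) + 1 = j → (a k : ℕ) + t ≤ l)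
          = Finset.Iio (a ⟨0, hi⟩) := by
        ext l
        simp only [Finset.mem_filter, Finset.mem_univ, true_and, Finset.mem_Iio]
        constructor
        · rintro ⟨j, hj, hl, -⟩
          have : j = ⟨0, hi⟩ := Fin.ext (by simpa using hj)
          rwa [← this]
        · intro hl
          exact ⟨⟨0, hi⟩, le_rfl, hl, fun k hk => by simp at hk⟩
      rw [this, Fin.card_Iio]
      simp
    | succ i ih =>
      intro hi
      have hi' : i < e + 1 := by omega
      have hstep := ha ⟨i, hi'⟩ ⟨i + 1, hi⟩ rfl
      have hlt := (a ⟨i + 1, hi⟩).2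
      have hun : (Finset.univ.filter fun l : Fin n => ∃ j : Fin (e + 1),
          (j : ℕ) ≤ i + 1 ∧ l < a j ∧ ∀ k : Fin (e + 1), (k : ℕ) + 1 = j → (a k : ℕ) + t ≤ l)
          = (Finset.univ.filter fun l : Fin n => ∃ j : Fin (e + 1),
            (j : ℕ) ≤ i ∧ l < a j ∧ ∀ k : Fin (e + 1), (k : ℕ) + 1 = j → (a k : ℕ) + t ≤ l) ∪
            Finset.Ico (⟨a ⟨i, hi'⟩ + t, by omega⟩ : Fin n) (a ⟨i + 1, hi⟩) := by
        ext l
        simp only [Finset.mem_filter, Finset.mem_univ, true_and, Finset.mem_Ico, Finset.mem_union]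
        constructor
        · rintro ⟨j, hj, hl, hp⟩
          rcases Nat.lt_or_ge i j with hij | hij
          · have hj' : j = ⟨i + 1, hi⟩ := Fin.ext (by simp; omega)
            subst hj'
            exact Or.inr ⟨Fin.le_def.mpr (hp ⟨i, hi'⟩ rfl), hl⟩
          · exact Or.inl ⟨j, hij, hl, hp⟩
        · rintro (⟨j, hj, hl, hp⟩ | ⟨h1, h2⟩)
          · exact ⟨j, by omega, hl, hp⟩
          · refine ⟨⟨i + 1, hi⟩, le_rfl, h2, fun k hk => ?_⟩
            have hk' : k = ⟨i, hi'⟩ := Fin.ext (by simpa using hk)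
            rw [hk']
            exact Fin.le_def.mp h1
      rw [hun, Finset.card_union_of_disjoint, Fin.card_Ico]
      · have := ih hi'
        simp only [add_mul, one_mul]
        omega
      · rw [Finset.disjoint_left]
        intro l hl hl'
        simp only [Finset.mem_filter, Finset.mem_univ, true_and, Finset.mem_Ico] at hl hl'
        obtain ⟨j, hj, hlj, -⟩ := hl
        have h1 : a j ≤ a ⟨i, hi'⟩ := hm (Fin.le_def.mpr hj)
        have h2 := Fin.le_def.mp hl'.1
        have h3 := Fin.lt_def.mp (lt_of_lt_of_le hlj h1)
        simp only at h2
        omega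
  rw [show Fin.last e = ⟨e, Nat.lt_succ_self e⟩ from rfl, ← key e (Nat.lt_succ_self e)]
  congr 2
  ext l
  simp only [gaps, Finset.mem_filter, Finset.mem_univ, true_and]
  exact ⟨fun ⟨j, h1, h2⟩ => ⟨j, Nat.lt_succ_iff.mp j.2, h1, h2⟩, fun ⟨j, _, h1, h2⟩ => ⟨j, h1, h2⟩⟩

/-! ### Hilbert series by smallest t-spread divisors -/

open Classical in
/-- The exponents of the monomials of degree `m` in the ideal generated by `A`. -/
noncomputable def monomialsIn (A : Finset (Fin d → Fin n)) (m : ℕ) : Finset (Fin n →₀ ℕ) :=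
  (Finset.univ.finsuppAntidiag m).filter fun s => ∃ a ∈ A, expo a ≤ s

lemma mem_monomialsIn {A : Finset (Fin d → Fin n)} {m : ℕ} {s : Fin n →₀ ℕ} :
    s ∈ monomialsIn A m ↔ ∑ l, s l = m ∧ ∃ a ∈ A, expo a ≤ s := by
  simp [monomialsIn]

lemma coeff_mk_one_pow_card (C : Finset (Fin n)) (m : ℕ) :
    PowerSeries.coeff m ((PowerSeries.mk 1 : PowerSeries ℤ) ^ C.card)
      = (C.finsuppAntidiag m).card := by
  classical
  rw [← Finset.prod_const, PowerSeries.coeff_prod]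
  simp

-- Dividing by the monomial of a identifies this class with the monomials supported outside the
-- gaps, since on the gaps the exponents are forced.
open Classical in
lemma mk_card_isCanonical (t : ℕ) (a : Fin d → Fin n) :
    (PowerSeries.mk fun m => (((Finset.univ.finsuppAntidiag m).filter
      fun s => IsCanonical t a s).card : ℤ))
      = PowerSeries.X ^ d * (PowerSeries.mk 1 : PowerSeries ℤ) ^ ((gaps t a)ᶜ).card := by
  ext m
  rw [PowerSeries.coeff_mk, PowerSeries.coeff_X_pow_mul', coeff_mk_one_pow_card]
  split_ifs with h
  · norm_cast
    refine Finset.card_bij' (fun s _ => s - expo a) (fun r _ => expo a + r) ?_ ?_ ?_ ?_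
    · intro s hs
      simp only [Finset.mem_filter, Finset.mem_finsuppAntidiag, Finset.subset_univ,
        and_true] at hs ⊢
      obtain ⟨hs, hle, hg⟩ := hs
      have hsupp : (s - expo a).support ⊆ (gaps t a)ᶜ := by
        intro l hl
        rw [Finset.mem_compl]
        intro hc
        have := hg l hc
        simp [this] at hl
      refine ⟨?_, hsupp⟩
      rw [Finset.sum_subset (Finset.subset_univ _)
        (fun l _ hl => Finsupp.notMem_support_iff.mp fun hc => hl (hsupp hc))]
      have h1 : ∑ l, (s - expo a) l + ∑ l, expo a l = ∑ l, s l := by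
        rw [← Finset.sum_add_distrib]
        refine Finset.sum_congr rfl fun l _ => ?_
        have := hle l
        simp only [Finsupp.tsub_apply]
        omega
      rw [sum_expo] at h1
      change ∑ l, (s - expo a) l = m - d
      change ∑ l, s l = m at hs
      omega
    · intro r hr
      simp only [Finset.mem_filter, Finset.mem_finsuppAntidiag, Finset.subset_univ,
        and_true] at hr ⊢
      obtain ⟨hr, hsupp⟩ := hr
      have h0 : ∀ l, l ∉ (gaps t a)ᶜ → r l = 0 :=
        fun l hl => Finsupp.notMem_support_iff.mp fun hc => hl (hsupp hc)
      rw [Finset.sum_subset (Finset.subset_univ _) (fun l _ hl => h0 l hl)] at hr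
      refine ⟨?_, le_self_add, fun l hl => ?_⟩
      · change ∑ l, (expo a + r) l = m
        change ∑ l, r l = m - d at hr
        simp only [Finsupp.add_apply, Finset.sum_add_distrib, sum_expo]
        omega
      · simp [h0 l (by simpa using hl)]
    · intro s hs
      simp only [Finset.mem_filter] at hs
      exact add_tsub_cancel_of_le hs.2.1
    · intro r hr
      simp
  · norm_cast
    rw [Finset.card_eq_zero, Finset.filter_eq_empty_iff]
    intro s hs hc
    simp only [Finset.mem_finsuppAntidiag, Finset.subset_univ, and_true] at hs
    have := Finset.sum_le_sum fun l (_ : l ∈ Finset.univ) => hc.1 l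
    rw [sum_expo, hs] at this
    exact h this

/-- The Hilbert series of a monomial ideal generated by a set of `t`-spread monomials that is
closed under componentwise decrease of the index sequences. -/
theorem hilbertSeries_of_isLowerSet {t : ℕ} (A : Finset (Fin d → Fin n))
    (hA : A ⊆ spreadMonomials n d t)
    (hlow : ∀ a ∈ A, ∀ b ∈ spreadMonomials n d t, (∀ j, b j ≤ a j) → b ∈ A) :
    (PowerSeries.mk fun m => ((monomialsIn A m).card : ℤ)) * (1 - PowerSeries.X) ^ n
      = PowerSeries.X ^ d * ∑ a ∈ A, (1 - PowerSeries.X) ^ (gaps t a).card := by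
  classical
  have h1 : (PowerSeries.mk fun m => ((monomialsIn A m).card : ℤ)) = ∑ a ∈ A,
      PowerSeries.mk fun m => (((Finset.univ.finsuppAntidiag m).filter
        fun s => IsCanonical t a s).card : ℤ) := by
    ext m
    simp only [map_sum, PowerSeries.coeff_mk]
    norm_cast
    -- The classes of the canonical divisors partition the monomials of the ideal; closure under
    -- decrease keeps the canonical divisor in A, and mutual comparison makes it unique.
    rw [← Finset.card_biUnion]
    · congr 1
      ext s
      simp only [mem_monomialsIn, Finset.mem_biUnion, Finset.mem_filter,
        Finset.mem_finsuppAntidiag, Finset.subset_univ, and_true]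
      constructor
      · rintro ⟨hs, b, hb, hbs⟩
        obtain ⟨a, ha, hc⟩ := exists_isCanonical (hA hb) hbs
        exact ⟨a, hlow b hb a ha (hc.le_of_expo_le ha (hA hb) hbs), hs, hc⟩
      · rintro ⟨a, ha, hs, hc⟩
        exact ⟨hs, a, ha, hc.1⟩
    · intro a ha b hb hab
      rw [Function.onFun, Finset.disjoint_left]
      intro s hs hs'
      simp only [Finset.mem_filter] at hs hs'
      exact hab (funext fun j => le_antisymm
        (hs.2.le_of_expo_le (hA ha) (hA hb) hs'.2.1 j)
        (hs'.2.le_of_expo_le (hA hb) (hA ha) hs.2.1 j))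
  rw [h1, Finset.sum_mul, Finset.mul_sum]
  refine Finset.sum_congr rfl fun a _ => ?_
  rw [mk_card_isCanonical, mul_assoc]
  congr 1
  have hc : ((gaps t a)ᶜ).card + (gaps t a).card = n := by
    rw [Finset.card_compl_add_card, Fintype.card_fin]
  rw [show (1 - PowerSeries.X : PowerSeries ℤ) ^ n
      = (1 - PowerSeries.X) ^ ((gaps t a)ᶜ.card + (gaps t a).card) by rw [hc], pow_add, ← mul_assoc, ← mul_pow, PowerSeries.mk_one_mul_one_sub_eq_one, one_pow, one_mul]

end Combinatorics

/-! ### Hilbert functions of graded free modules -/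

section HilbertFunction

variable {K : Type*} [Field K] {n : ℕ}

/-- The products of spaces of polynomials with prescribed supports have the expected dimension. -/
lemma finrank_pi_restrictSupport {r : ℕ} (T : Fin r → Finset (Fin n →₀ ℕ)) :
    FiniteDimensional K (Submodule.pi Set.univ
      fun k => restrictSupport K (T k : Set (Fin n →₀ ℕ))) ∧
    Module.finrank K (Submodule.pi Set.univ
      fun k => restrictSupport K (T k : Set (Fin n →₀ ℕ))) = ∑ k, (T k).card := by
  have hfin : ∀ k, Module.Finite K (restrictSupport K (T k : Set (Fin n →₀ ℕ))) := fun k =>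
    Module.Finite.of_basis (basisRestrictSupport K (T k : Set (Fin n →₀ ℕ)))
  let φ : (Submodule.pi Set.univ fun k => restrictSupport K (T k : Set (Fin n →₀ ℕ))) ≃ₗ[K]
      ((k : Fin r) → restrictSupport K (T k : Set (Fin n →₀ ℕ))) :=
    { toFun := fun v k => ⟨v.1 k, v.2 k (Set.mem_univ k)⟩
      invFun := fun v => ⟨fun k => (v k).1, fun k _ => (v k).2⟩
      map_add' := fun _ _ => rfl
      map_smul' := fun _ _ => rfl
      left_inv := fun _ => rfl
      right_inv := fun _ => rfl }
  refine ⟨Module.Finite.equiv φ.symm, ?_⟩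
  rw [φ.finrank_eq, Module.finrank_pi_fintype]
  refine Finset.sum_congr rfl fun k _ => ?_
  rw [Module.finrank_eq_nat_card_basis (basisRestrictSupport K (T k : Set (Fin n →₀ ℕ)))]
  simp

open Classical in
/-- The exponents of the monomials of degree `m - c`. -/
noncomputable def shiftedMonomials (n c m : ℕ) : Finset (Fin n →₀ ℕ) :=
  if c ≤ m then Finset.univ.finsuppAntidiag (m - c) else ∅

lemma mem_shiftedMonomials {c m : ℕ} {s : Fin n →₀ ℕ} :
    s ∈ shiftedMonomials n c m ↔ s.degree + c = m := by
  rw [shiftedMonomials, Finsupp.degree_eq_sum]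
  split_ifs with h
  · simp only [Finset.mem_finsuppAntidiag, Finset.subset_univ, and_true]
    change ∑ l, s l = m - c ↔ _
    omega
  · simp only [Finset.notMem_empty, false_iff]
    omega

/-- This is the Hilbert series X^c / (1 - X)^n of S(-c), cleared of its denominator. -/
lemma mk_card_shiftedMonomials (c : ℕ) :
    (PowerSeries.mk fun m => ((shiftedMonomials n c m).card : ℤ)) * (1 - PowerSeries.X) ^ n
      = PowerSeries.X ^ c := by
  have : (PowerSeries.mk fun m => ((shiftedMonomials n c m).card : ℤ))
      = PowerSeries.X ^ c * (PowerSeries.mk 1) ^ n := by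
    ext m
    have h := coeff_mk_one_pow_card (Finset.univ : Finset (Fin n)) (m - c)
    rw [Finset.card_univ, Fintype.card_fin] at h
    rw [PowerSeries.coeff_X_pow_mul', PowerSeries.coeff_mk, h, shiftedMonomials]
    split_ifs
    · congr!
    · simp
  rw [this, mul_assoc, ← mul_pow, PowerSeries.mk_one_mul_one_sub_eq_one, one_pow, mul_one]

variable (K) in
/-- The component of degree `m` of `⨁ₖ S(-deg k)`. -/
noncomputable def homVec {r : ℕ} (deg : Fin r → ℕ) (m : ℕ) : Submodule K (Fin r → MvPolynomial (Fin n) K) :=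
  Submodule.pi Set.univ
    fun k => restrictSupport K (shiftedMonomials n (deg k) m : Set (Fin n →₀ ℕ))

lemma mem_homVec {r : ℕ} {deg : Fin r → ℕ} {m : ℕ} {v : Fin r → MvPolynomial (Fin n) K} :
    v ∈ homVec K deg m ↔ IsHomogeneousVec deg m v := by
  simp only [homVec, Submodule.mem_pi, Set.mem_univ, true_imp_iff, mem_restrictSupport_iff,
    IsHomogeneousVec, Set.subset_def, Finset.mem_coe, mem_shiftedMonomials]

instance {r : ℕ} (deg : Fin r → ℕ) (m : ℕ) : FiniteDimensional K (homVec (n := n) K deg m) :=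
  (finrank_pi_restrictSupport _).1

lemma finrank_homVec {r : ℕ} (deg : Fin r → ℕ) (m : ℕ) :
    Module.finrank K (homVec (n := n) K deg m) = ∑ k, (shiftedMonomials n (deg k) m).card :=
  (finrank_pi_restrictSupport _).2

lemma vecComponent_of_ne {r : ℕ} {deg : Fin r → ℕ} {m m' : ℕ}
    {v : Fin r → MvPolynomial (Fin n) K} (hv : IsHomogeneousVec deg m' v) (h : m' ≠ m) :
    vecComponent deg m v = 0 := by
  funext k
  ext s
  rw [coeff_vecComponent]
  split_ifs with hs
  · by_contra hc
    exact h ((hv k s (mem_support_iff.mpr hc)).symm.trans hs)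
  · simp

section Graded

variable {a b : ℕ} {da : Fin a → ℕ} {db : Fin b → ℕ}
  {f : (Fin a → MvPolynomial (Fin n) K) →ₗ[MvPolynomial (Fin n) K]
    (Fin b → MvPolynomial (Fin n) K)}

lemma vecComponent_map (hf : ∀ m v, IsHomogeneousVec da m v → IsHomogeneousVec db m (f v)) (m : ℕ)
    (v : Fin a → MvPolynomial (Fin n) K) :
    vecComponent db m (f v) = f (vecComponent da m v) := by
  obtain ⟨M, hM⟩ := vec_eq_sum_components da v
  conv_lhs => rw [hM]
  conv_rhs => rw [hM]
  rw [map_sum, vecComponent_sum, vecComponent_sum, map_sum]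
  refine Finset.sum_congr rfl fun m' _ => ?_
  have h := isHomogeneousVec_vecComponent da m' v
  by_cases hm : m' = m
  · subst hm
    rw [(isHomogeneousVec_iff _ _ _).mp (hf _ _ h), (isHomogeneousVec_iff _ _ _).mp h]
  · rw [vecComponent_of_ne (hf _ _ h) hm, vecComponent_of_ne h hm, map_zero]

/-- Rank-nullity in degree m. A homogeneous element of the range has a homogeneous preimage, namely
the degree m component of any preimage. -/
lemma finrank_homVec_eq_add
    (hf : ∀ m v, IsHomogeneousVec da m v → IsHomogeneousVec db m (f v)) (m : ℕ) :
    Module.finrank K (homVec (n := n) K da m)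
      = Module.finrank K ((LinearMap.range f).restrictScalars K ⊓ homVec K db m :
          Submodule K (Fin b → MvPolynomial (Fin n) K))
        + Module.finrank K ((LinearMap.ker f).restrictScalars K ⊓ homVec K da m :
          Submodule K (Fin a → MvPolynomial (Fin n) K)) := by
  let g := (f.restrictScalars K).domRestrict (homVec K da m)
  have hr : LinearMap.range g = (LinearMap.range f).restrictScalars K ⊓ homVec K db m := by
    ext w
    simp only [LinearMap.mem_range, Submodule.mem_inf, Submodule.restrictScalars_mem, mem_homVec]
    constructor
    · rintro ⟨v, rfl⟩
      exact ⟨⟨v.1, rfl⟩, hf m _ (mem_homVec.mp v.2)⟩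
    · rintro ⟨⟨v, rfl⟩, hw⟩
      refine ⟨⟨vecComponent da m v, mem_homVec.mpr (isHomogeneousVec_vecComponent _ _ _)⟩, ?_⟩
      change f (vecComponent da m v) = f v
      rw [← vecComponent_map hf, (isHomogeneousVec_iff _ _ _).mp hw]
  have hk : (LinearMap.ker g).map (homVec K da m).subtype
      = (LinearMap.ker f).restrictScalars K ⊓ homVec K da m := by
    ext v
    simp only [Submodule.mem_map, Submodule.mem_inf, Submodule.restrictScalars_mem,
      LinearMap.mem_ker]
    constructor
    · rintro ⟨v, hv, rfl⟩
      exact ⟨hv, v.2⟩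
    · rintro ⟨h1, h2⟩
      exact ⟨⟨v, h2⟩, h1, rfl⟩
  rw [← hr, ← hk, Submodule.finrank_map_subtype_eq]
  exact (LinearMap.finrank_range_add_finrank_ker g).symm

end Graded

/-! ### Betti numbers of ideals with linear resolution -/

section MonomialIdeals

variable {d : ℕ}

lemma prod_X_eq_monomial (a : Fin d → Fin n) :
    ∏ j, (X (a j) : MvPolynomial (Fin n) K) = monomial (expo a) 1 := by
  rw [expo, monomial_sum_one]
  rfl

lemma mem_monomialIdeal {A : Finset (Fin d → Fin n)} {p : MvPolynomial (Fin n) K} :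
    p ∈ monomialIdeal K A ↔ ∀ s ∈ p.support, ∃ a ∈ A, expo a ≤ s := by
  have : (fun a : Fin d → Fin n => ∏ j, (X (a j) : MvPolynomial (Fin n) K)) '' (A : Set _)
      = (fun s => monomial s 1) '' (expo '' (A : Set (Fin d → Fin n))) := by
    rw [Set.image_image]
    simp only [prod_X_eq_monomial]
  rw [monomialIdeal, this, mem_ideal_span_monomial_image]
  simp

lemma monomialIdeal_isHomogeneous (A : Finset (Fin d → Fin n)) :
    ∀ p ∈ monomialIdeal K A, ∀ m, homogeneousComponent m p ∈ monomialIdeal K A := by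
  intro p hp m
  rw [mem_monomialIdeal] at hp ⊢
  intro s hs
  refine hp s ?_
  rw [mem_support_iff, coeff_homogeneousComponent] at hs
  exact mem_support_iff.mpr fun h => hs (by simp [h])

lemma mem_irrelevant_of_coeff_zero {p : MvPolynomial (Fin n) K} (hp : coeff 0 p = 0) :
    p ∈ Ideal.span (Set.range (X : Fin n → MvPolynomial (Fin n) K)) := by
  rw [← Set.image_univ, mem_ideal_span_X_image]
  intro s hs
  have hs0 : s ≠ 0 := by
    rintro rfl
    exact mem_support_iff.mp hs hp
  obtain ⟨j, hj⟩ := Finsupp.ne_iff.mp hs0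
  exact ⟨j, Set.mem_univ _, hj⟩

lemma coeff_zero_of_mem_irrelevant {p : MvPolynomial (Fin n) K}
    (hp : p ∈ Ideal.span (Set.range (X : Fin n → MvPolynomial (Fin n) K))) : coeff 0 p = 0 := by
  rw [← Set.image_univ, mem_ideal_span_X_image] at hp
  by_contra hc
  obtain ⟨j, -, hj⟩ := hp 0 (mem_support_iff.mpr hc)
  exact hj rfl

/-- Each term is a generator of degree d times a monomial, and that cofactor is not constant because
the degrees m and d differ. -/
lemma mem_irrelevant_mul_monomialIdeal {A : Finset (Fin d → Fin n)} {m : ℕ}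
    {p : MvPolynomial (Fin n) K} (hp : p ∈ monomialIdeal K A) (hpm : p.IsHomogeneous m)
    (hm : m ≠ d) :
    p ∈ Ideal.span (Set.range (X : Fin n → MvPolynomial (Fin n) K)) * monomialIdeal K A := by
  rw [p.as_sum]
  refine Ideal.sum_mem _ fun s hs => ?_
  obtain ⟨a, ha, has⟩ := mem_monomialIdeal.mp hp s hs
  have h1 : monomial s (coeff s p) = monomial (s - expo a) (coeff s p) * monomial (expo a) 1 := by
    rw [monomial_mul, tsub_add_cancel_of_le has, mul_one]
  rw [h1]
  refine Ideal.mul_mem_mul (mem_irrelevant_of_coeff_zero ?_)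
    (Ideal.subset_span ⟨a, ha, prod_X_eq_monomial a⟩)
  rw [coeff_monomial, if_neg]
  intro h0
  have hs' : s = expo a := by rw [← tsub_add_cancel_of_le has, h0, zero_add]
  have h2 : s.degree = m := by
    rw [Finsupp.degree_eq_weight_one]
    exact hpm (mem_support_iff.mp hs)
  rw [hs', Finsupp.degree_eq_sum, sum_expo] at h2
  exact hm h2.symm

/-- The generators in a minimal resolution of an ideal generated by monomials of degree `d` have
degree `d`. -/
lemma deg_zero_eq {A : Finset (Fin d → Fin n)}
    (R : MinimalGradedFreeResolution (monomialIdeal K A)) (k : Fin (R.rank 0)) :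
    R.deg 0 k = d := by
  by_contra hne
  set 𝔪 := Ideal.span (Set.range (X : Fin n → MvPolynomial (Fin n) K)) with h𝔪
  let e : Fin (R.rank 0) → MvPolynomial (Fin n) K := Pi.single k 1
  have he : IsHomogeneousVec (R.deg 0) (R.deg 0 k) e := by
    intro j s hs
    rcases eq_or_ne j k with rfl | hj
    · have : s = 0 := by
        by_contra hs0
        rw [mem_support_iff] at hs
        simp [e, coeff_one, Ne.symm hs0] at hs
      simp [this]
    · simp [e, hj] at hs
  have h1 : R.aug e ∈ 𝔪 * monomialIdeal K A :=
    mem_irrelevant_mul_monomialIdeal (R.range_aug.le ⟨e, rfl⟩)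
      (R.aug_homogeneous _ _ he) hne
  have h2 : 𝔪 * monomialIdeal K A = (𝔪 • ⊤ : Submodule (MvPolynomial (Fin n) K) _).map R.aug := by
    rw [Submodule.map_smul'', Submodule.map_top, R.range_aug]
    rfl
  rw [h2] at h1
  obtain ⟨w, hw, hwe⟩ := h1
  have hwk : w k ∈ 𝔪 := by
    refine Submodule.smul_induction_on (p := fun w => w k ∈ 𝔪) hw ?_ ?_
    · intro r hr y _
      exact 𝔪.mul_mem_right _ hr
    · intro y z hy hz
      exact 𝔪.add_mem hy hz
  -- The basis vector e and w ∈ 𝔪F₀ have the same image, so e - w is a syzygy. By minimality it has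
  -- coordinates in 𝔪, which would put 1 in 𝔪.
  have h4 : e - w ∈ LinearMap.range (R.diff 0) := by
    rw [R.exact_zero, LinearMap.mem_ker, map_sub, hwe, sub_self]
  obtain ⟨y, hy⟩ := h4
  have h5 := R.minimal 0 y k
  rw [hy] at h5
  have h6 : (1 : MvPolynomial (Fin n) K) ∈ 𝔪 := by
    have := 𝔪.add_mem h5 hwk
    simpa [e] using this
  have := coeff_zero_of_mem_irrelevant h6
  simp at this

/-- Linearity constrains only i > 0, so degree d of the generators comes from `deg_zero_eq`. The
resolution is the one chosen inside `gradedBetti`, which makes the count of summands equal to its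
rank. -/
lemma deg_eq_of_linear {A : Finset (Fin d → Fin n)}
    (hlin : HasLinearResolution d (monomialIdeal K A)) :
    ∃ R : MinimalGradedFreeResolution (monomialIdeal K A),
      (∀ i k, R.deg i k = d + i) ∧ ∀ i, gradedBetti (monomialIdeal K A) i (i + d) = R.rank i := by
  classical
  have hne := exists_minimalGradedFreeResolution (monomialIdeal K A)
    (monomialIdeal_isHomogeneous A)
  have hdeg : ∀ i k, hne.some.deg i k = d + i := by
    intro i k
    rcases Nat.eq_zero_or_pos i with rfl | hi
    · exact deg_zero_eq _ k
    · by_contra hk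
      have h := hlin i _ hi hk
      rw [gradedBetti, dif_pos hne, Finset.card_eq_zero, Finset.filter_eq_empty_iff] at h
      exact h (Finset.mem_univ k) rfl
  refine ⟨hne.some, hdeg, fun i => ?_⟩
  rw [gradedBetti, dif_pos hne, Finset.filter_true_of_mem (fun k _ => by rw [hdeg, add_comm])]
  simp

lemma finrank_monomialIdeal (A : Finset (Fin d → Fin n)) (m : ℕ)
    (N : Submodule (MvPolynomial (Fin n) K) (Fin 1 → MvPolynomial (Fin n) K))
    (hN : ∀ v, v ∈ N ↔ v 0 ∈ monomialIdeal K A) :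
    Module.finrank K (N.restrictScalars K ⊓ homVec K (fun _ => 0) m :
      Submodule K (Fin 1 → MvPolynomial (Fin n) K)) = (monomialsIn A m).card := by
  have h : (N.restrictScalars K ⊓ homVec K (fun _ => 0) m :
      Submodule K (Fin 1 → MvPolynomial (Fin n) K)) = Submodule.pi Set.univ
        fun _ => restrictSupport K (monomialsIn A m : Set (Fin n →₀ ℕ)) := by
    ext v
    simp only [Submodule.mem_inf, Submodule.restrictScalars_mem, hN, mem_homVec, Submodule.mem_pi,
      Set.mem_univ, true_imp_iff, mem_restrictSupport_iff, mem_monomialIdeal, IsHomogeneousVec,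
      Set.subset_def, Finset.mem_coe, mem_monomialsIn, Finsupp.degree_eq_sum, add_zero,
      Fin.forall_fin_one]
    exact ⟨fun h s hs => ⟨h.2 s hs, h.1 s hs⟩,
      fun h => ⟨fun s hs => (h s hs).2, fun s hs => (h s hs).1⟩⟩
  rw [h, (finrank_pi_restrictSupport _).2]
  simp

/-- The linear Betti numbers are read off from the Hilbert series. -/
theorem coeff_hilbertSeries_of_linear {A : Finset (Fin d → Fin n)}
    (R : MinimalGradedFreeResolution (monomialIdeal K A)) (hdeg : ∀ i k, R.deg i k = d + i)
    (i : ℕ) :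
    PowerSeries.coeff (i + d) ((PowerSeries.mk fun m => ((monomialsIn A m).card : ℤ)) *
      (1 - PowerSeries.X) ^ n) = (-1) ^ i * (R.rank i : ℤ) := by
  -- The target S is viewed as a free module of rank one, so that the augmentation is treated like
  -- the differentials.
  let aug' : (Fin (R.rank 0) → MvPolynomial (Fin n) K) →ₗ[MvPolynomial (Fin n) K]
      (Fin 1 → MvPolynomial (Fin n) K) := LinearMap.pi fun _ => R.aug
  have haug : ∀ m v, IsHomogeneousVec (R.deg 0) m v →
      IsHomogeneousVec (fun _ => 0) m (aug' v) := by
    intro m v hv k s hs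
    rw [Finsupp.degree_eq_weight_one]
    exact R.aug_homogeneous m v hv (mem_support_iff.mp hs)
  have hker : LinearMap.ker aug' = LinearMap.ker R.aug := by
    ext v
    exact ⟨fun h => congrFun h 0, fun h => funext fun _ => h⟩
  let Z : ℕ → PowerSeries ℤ := fun j => PowerSeries.mk fun m =>
    (Module.finrank K ((LinearMap.range (R.diff j)).restrictScalars K ⊓ homVec K (R.deg j) m :
      Submodule K (Fin (R.rank j) → MvPolynomial (Fin n) K)) : ℤ)
  let H : PowerSeries ℤ := PowerSeries.mk fun m => ((monomialsIn A m).card : ℤ)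
  have hV : ∀ j, (PowerSeries.mk fun m => (Module.finrank K (homVec (n := n) K (R.deg j) m) : ℤ))
      * (1 - PowerSeries.X) ^ n = (R.rank j : PowerSeries ℤ) * PowerSeries.X ^ (d + j) := by
    intro j
    rw [← mk_card_shiftedMonomials (n := n), ← mul_assoc]
    congr 1
    ext m
    rw [← map_natCast (PowerSeries.C (R := ℤ)), PowerSeries.coeff_C_mul]
    simp [finrank_homVec, hdeg]
  have h0 : H * (1 - PowerSeries.X) ^ n
      = (R.rank 0 : PowerSeries ℤ) * PowerSeries.X ^ (d + 0) - Z 0 * (1 - PowerSeries.X) ^ n := by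
    rw [← hV, ← sub_mul]
    congr 1
    ext m
    simp only [map_sub, PowerSeries.coeff_mk, H, Z]
    have h1 := finrank_homVec_eq_add haug m
    rw [finrank_monomialIdeal A m _ (fun v => ?_), hker, ← R.exact_zero] at h1
    · rw [h1]
      push_cast
      ring
    · constructor
      · rintro ⟨w, rfl⟩
        exact R.range_aug.le ⟨w, rfl⟩
      · intro hv
        obtain ⟨w, hw⟩ := R.range_aug.ge hv
        exact ⟨w, funext fun k => by rw [Subsingleton.elim k 0, ← hw]; rfl⟩
  have hstep : ∀ j, Z j * (1 - PowerSeries.X) ^ n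
      = (R.rank (j + 1) : PowerSeries ℤ) * PowerSeries.X ^ (d + (j + 1)) - Z (j + 1) * (1 - PowerSeries.X) ^ n := by
    intro j
    rw [← hV, ← sub_mul]
    congr 1
    ext m
    simp only [map_sub, PowerSeries.coeff_mk, Z]
    rw [finrank_homVec_eq_add (R.diff_homogeneous j) m, R.exact_succ]
    push_cast
    ring
  -- The Euler characteristic is truncated with an explicit remainder, so finite length of the
  -- resolution plays no role.
  have hsum : ∀ N, H * (1 - PowerSeries.X) ^ n
      = ∑ j ∈ Finset.range (N + 1), (-1) ^ j * (R.rank j : PowerSeries ℤ) * PowerSeries.X ^ (d + j)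
        + (-1) ^ (N + 1) * (Z N * (1 - PowerSeries.X) ^ n) := by
    intro N
    induction N with
    | zero =>
      rw [h0]
      simp
      ring
    | succ N ih =>
      rw [ih, Finset.sum_range_succ _ (N + 1), hstep N]
      ring
  -- The remainder lives in Fᵢ₊₁, which vanishes below degree d + i + 1, hence it does not reach the
  -- coefficient at i + d.
  have hZ : ∀ m < d + (i + 1), PowerSeries.coeff m (Z (i + 1)) = 0 := by
    intro m hm
    simp only [Z, PowerSeries.coeff_mk]
    have hb : homVec (n := n) K (R.deg (i + 1)) m = ⊥ := by
      apply Submodule.finrank_eq_zero.mp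
      rw [finrank_homVec]
      refine Finset.sum_eq_zero fun k _ => ?_
      rw [hdeg, shiftedMonomials, if_neg (by omega), Finset.card_empty]
    rw [hb, inf_bot_eq, finrank_bot]
    rfl
  have hZd : PowerSeries.X ^ (d + (i + 1)) ∣
      (-1) ^ (i + 1 + 1) * (Z (i + 1) * (1 - PowerSeries.X) ^ n) :=
    Dvd.dvd.mul_left (Dvd.dvd.mul_right (PowerSeries.X_pow_dvd_iff.mpr hZ) _) _
  change PowerSeries.coeff (i + d) (H * (1 - PowerSeries.X) ^ n) = _
  rw [hsum (i + 1), map_add, PowerSeries.X_pow_dvd_iff.mp hZd _ (by omega), add_zero, map_sum,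
    Finset.sum_eq_single i]
  · rw [show ((-1) ^ i * (R.rank i : PowerSeries ℤ)) = PowerSeries.C ((-1) ^ i * (R.rank i : ℤ)) by
      simp, PowerSeries.coeff_C_mul, add_comm i d, PowerSeries.coeff_X_pow_self, mul_one]
  · intro j _ hj
    rw [show ((-1) ^ j * (R.rank j : PowerSeries ℤ)) = PowerSeries.C ((-1) ^ j * (R.rank j : ℤ)) by
      simp, PowerSeries.coeff_C_mul, PowerSeries.coeff_X_pow, if_neg (by omega), mul_zero]
  · intro hi
    exact absurd (Finset.mem_range.mpr (by omega)) hi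

end MonomialIdeals

end HilbertFunction

/-! ### The lexicographic order on index sequences -/

section Final

variable {n d : ℕ}

lemma slexGE_or_slexGT (a b : Fin d → Fin n) : SlexGE a b ∨ SlexGT b a := by
  by_cases hab : a = b
  · exact Or.inl (Or.inl hab)
  obtain ⟨j, hj⟩ := Function.ne_iff.mp hab
  obtain ⟨s, hs, hmin⟩ := (Finset.univ.filter fun j => a j ≠ b j).exists_min_image id
    ⟨j, by simpa using hj⟩
  have heq : ∀ k < s, a k = b k := by
    intro k hk
    by_contra hc
    exact absurd (hmin k (by simpa using hc)) (not_le.mpr hk)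
  simp only [Finset.mem_filter, Finset.mem_univ, true_and] at hs
  rcases lt_or_gt_of_ne hs with h | h
  · exact Or.inl (Or.inr ⟨s, heq, h⟩)
  · exact Or.inr ⟨s, fun k hk => (heq k hk).symm, h⟩

lemma SlexGT.not_slexGE {a b : Fin d → Fin n} (h : SlexGT a b) : ¬ SlexGE b a := by
  obtain ⟨s, hs, hlt⟩ := h
  rintro (rfl | ⟨s', hs', hlt'⟩)
  · exact lt_irrefl _ hlt
  · rcases lt_trichotomy s s' with h | rfl | h
    · exact absurd hlt (by rw [hs' s h]; exact lt_irrefl _)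
    · exact absurd hlt hlt'.asymm
    · exact absurd hlt' (by rw [hs s' h]; exact lt_irrefl _)

lemma SlexGT.trans {a b c : Fin d → Fin n} (hab : SlexGT a b) (hbc : SlexGT b c) :
    SlexGT a c := by
  obtain ⟨s, hs, hlt⟩ := hab
  obtain ⟨s', hs', hlt'⟩ := hbc
  rcases lt_trichotomy s s' with h | rfl | h
  · exact ⟨s, fun k hk => (hs k hk).trans (hs' k (hk.trans h)), by rwa [← hs' s h]⟩
  · exact ⟨s, fun k hk => (hs k hk).trans (hs' k hk), hlt.trans hlt'⟩
  · exact ⟨s', fun k hk => (hs k (hk.trans h)).trans (hs' k hk), by rwa [hs s' h]⟩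

lemma SlexGE.trans {a b c : Fin d → Fin n} (hab : SlexGE a b) (hbc : SlexGE b c) :
    SlexGE a c := by
  rcases hab with rfl | hab
  · exact hbc
  · rcases hbc with rfl | hbc
    · exact Or.inr hab
    · exact Or.inr (hab.trans hbc)

/-- This makes initial lexsegments closed under componentwise decrease and final ones under
componentwise increase. -/
lemma slexGE_of_le {a b : Fin d → Fin n} (h : ∀ j, a j ≤ b j) : SlexGE a b := by
  rcases slexGE_or_slexGT a b with h' | ⟨s, -, hs⟩
  · exact h'
  · exact absurd hs (not_lt.mpr (h s))

lemma mem_initialLexSegment {t : ℕ} {v w : Fin d → Fin n} :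
    w ∈ initialLexSegment t v ↔ w ∈ spreadMonomials n d t ∧ SlexGE w v := by
  simp [initialLexSegment]

lemma mem_finalLexSegment {t : ℕ} {u w : Fin d → Fin n} :
    w ∈ finalLexSegment t u ↔ w ∈ spreadMonomials n d t ∧ SlexGE u w := by
  simp [finalLexSegment]

/-! ### Reversal of the variables -/

/-- The index sequence of the image of a monomial under the reversal of the variables. -/
def revSeq (a : Fin d → Fin n) : Fin d → Fin n := fun j => (a j.rev).rev

lemma revSeq_revSeq (a : Fin d → Fin n) : revSeq (revSeq a) = a := by
  funext j
  simp [revSeq]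

lemma revSeq_mem_spreadMonomials {t : ℕ} {a : Fin d → Fin n} (ha : a ∈ spreadMonomials n d t) :
    revSeq a ∈ spreadMonomials n d t := by
  rw [mem_spreadMonomials] at ha ⊢
  intro j k hjk
  have h := ha k.rev j.rev (by simp only [Fin.val_rev]; omega)
  have h1 := (a k.rev).2
  have h2 := (a j.rev).2
  simp only [revSeq, Fin.val_rev]
  omega

lemma expo_revSeq (a : Fin d → Fin n) (l : Fin n) : expo (revSeq a) l = expo a l.rev := by
  rw [expo_apply, expo_apply]
  refine Finset.card_bij' (fun j _ => j.rev) (fun j _ => j.rev) ?_ ?_ ?_ ?_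
  · intro j hj
    simpa [revSeq, Fin.rev_eq_iff] using hj
  · intro j hj
    simpa [revSeq, Fin.rev_eq_iff] using hj
  · simp
  · simp

open Classical in
lemma card_monomialsIn_image_revSeq (A : Finset (Fin d → Fin n)) (m : ℕ) :
    (monomialsIn (A.image revSeq) m).card = (monomialsIn A m).card := by
  -- Stated for every B, because the inverse direction applies it to the reversed set and uses that
  -- reversal is an involution.
  have key : ∀ (B : Finset (Fin d → Fin n)) (s : Fin n →₀ ℕ), s ∈ monomialsIn B m →
      s.equivMapDomain Fin.revPerm ∈ monomialsIn (B.image revSeq) m := by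
    intro B s hs
    rw [mem_monomialsIn] at hs ⊢
    obtain ⟨hs, a, ha, hle⟩ := hs
    refine ⟨?_, revSeq a, Finset.mem_image_of_mem _ ha, fun l => ?_⟩
    · rw [← hs, ← Equiv.sum_comp Fin.revPerm]
      simp
    · rw [expo_revSeq]
      simpa using hle l.rev
  have hinv : ∀ s : Fin n →₀ ℕ,
      (s.equivMapDomain Fin.revPerm).equivMapDomain Fin.revPerm = s := by
    intro s
    ext l
    simp
  refine Finset.card_bij' (fun s _ => s.equivMapDomain Fin.revPerm)
    (fun s _ => s.equivMapDomain Fin.revPerm) ?_ (fun s hs => key A s hs)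
    (fun s _ => hinv s) (fun s _ => hinv s)
  intro s hs
  have h := key _ s hs
  rw [Finset.image_image, show (revSeq ∘ revSeq : (Fin d → Fin n) → _) = id from
    funext revSeq_revSeq, Finset.image_id] at h
  exact h

/-- The Hilbert series of a monomial ideal generated by a set of `t`-spread monomials that is
closed under componentwise increase of the index sequences. -/
theorem hilbertSeries_of_isUpperSet {t : ℕ} (A : Finset (Fin d → Fin n))
    (hA : A ⊆ spreadMonomials n d t)
    (hup : ∀ a ∈ A, ∀ b ∈ spreadMonomials n d t, (∀ j, a j ≤ b j) → b ∈ A) :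
    (PowerSeries.mk fun m => ((monomialsIn A m).card : ℤ)) * (1 - PowerSeries.X) ^ n
      = PowerSeries.X ^ d * ∑ a ∈ A, (1 - PowerSeries.X) ^ (gaps t (revSeq a)).card := by
  classical
  have h := hilbertSeries_of_isLowerSet (t := t) (A.image revSeq) ?_ ?_
  · simp only [card_monomialsIn_image_revSeq] at h
    rw [h, Finset.sum_image]
    intro a _ b _ hab
    rw [← revSeq_revSeq a, hab, revSeq_revSeq]
  · intro a ha
    obtain ⟨b, hb, rfl⟩ := Finset.mem_image.mp ha
    exact revSeq_mem_spreadMonomials (hA hb)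
  · intro a ha b hb hab
    obtain ⟨c, hc, rfl⟩ := Finset.mem_image.mp ha
    refine Finset.mem_image.mpr ⟨revSeq b, hup c hc _ (revSeq_mem_spreadMonomials hb) ?_,
      revSeq_revSeq b⟩
    intro j
    have := hab j.rev
    simp only [revSeq, Fin.rev_rev] at this ⊢
    exact Fin.le_rev_iff.mp this

/-! ### Gap counts and binomial coefficients -/

lemma maxIndex_eq {e t : ℕ} {a : Fin (e + 1) → Fin n} (ha : a ∈ spreadMonomials n (e + 1) t) :
    maxIndex a = a (Fin.last e) + 1 := by
  refine le_antisymm (Finset.sup_le fun j _ => ?_)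
    (Finset.le_sup (f := fun j => (a j : ℕ) + 1) (Finset.mem_univ _))
  exact Nat.succ_le_succ (Fin.le_def.mp (monotone_of_mem_spreadMonomials ha (Fin.le_last j)))

lemma minIndex_eq {e t : ℕ} {a : Fin (e + 1) → Fin n} (ha : a ∈ spreadMonomials n (e + 1) t) :
    minIndex a = a 0 + 1 := by
  refine le_antisymm (Nat.sInf_le ⟨0, rfl⟩) (le_csInf (Set.range_nonempty _) ?_)
  rintro _ ⟨j, rfl⟩
  exact Nat.succ_le_succ (Fin.le_def.mp (monotone_of_mem_spreadMonomials ha (Fin.zero_le j)))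

/-- The last -1 compensates for `maxIndex` counting from 1. By `card_gaps` the subtractions are
never truncated. -/
lemma card_gaps_eq_maxIndex {t : ℕ} (hd : 1 ≤ d) {a : Fin d → Fin n}
    (ha : a ∈ spreadMonomials n d t) : (gaps t a).card = maxIndex a - (d - 1) * t - 1 := by
  obtain ⟨e, rfl⟩ := Nat.exists_eq_add_of_le' hd
  rw [maxIndex_eq ha, ← card_gaps ha, Nat.add_sub_cancel]
  omega

lemma card_gaps_revSeq_eq_minIndex {t : ℕ} (hd : 1 ≤ d) {a : Fin d → Fin n}
    (ha : a ∈ spreadMonomials n d t) :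
    (gaps t (revSeq a)).card = n - minIndex a - (d - 1) * t := by
  obtain ⟨e, rfl⟩ := Nat.exists_eq_add_of_le' hd
  have h := card_gaps (revSeq_mem_spreadMonomials ha)
  rw [revSeq, Fin.rev_last, Fin.val_rev] at h
  rw [minIndex_eq ha, Nat.add_sub_cancel]
  exact Nat.eq_sub_of_add_eq h

lemma coeff_one_sub_X_pow (c i : ℕ) :
    PowerSeries.coeff i ((1 - PowerSeries.X : PowerSeries ℤ) ^ c) = (-1) ^ i * c.choose i := by
  have h : (1 - PowerSeries.X : PowerSeries ℤ) ^ c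
      = (((1 - Polynomial.X) ^ c : Polynomial ℤ) : PowerSeries ℤ) := by simp
  -- Substituting -X into 1 + X reduces to the binomial theorem and produces the sign.
  rw [h, Polynomial.coeff_coe, show (1 - Polynomial.X : Polynomial ℤ)
    = (1 + Polynomial.X).comp (Polynomial.C (-1) * Polynomial.X) by simp; ring,
    ← Polynomial.pow_comp, Polynomial.comp_C_mul_X_coeff, Polynomial.coeff_one_add_X_pow, mul_comm]

end Final

end TSpread

open TSpread in
theorem mainTheorem3 {K : Type*} [Field K] (n d t : ℕ) (hd : 1 ≤ d) (u v : Fin d → Fin n)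
    (hu : u ∈ TSpread.spreadMonomials n d t) (hv : v ∈ TSpread.spreadMonomials n d t)
    (huv : TSpread.SlexGE u v)
    (hcomp : TSpread.IsCompletelyLexsegment K t u v)
    (hlin : TSpread.HasLinearResolution d (TSpread.monomialIdeal K (TSpread.lexSegment t u v)))
    (i : ℕ) :
    (TSpread.gradedBetti (TSpread.monomialIdeal K (TSpread.lexSegment t u v)) i (i + d) : ℤ) =
      ∑ w ∈ TSpread.finalLexSegment t u,
        ((n - TSpread.minIndex w - (d - 1) * t).choose i : ℤ) -
      ∑ w ∈ (TSpread.finalLexSegment t v).erase v,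
        ((TSpread.maxIndex w - (d - 1) * t - 1).choose i : ℤ) := by
  classical
  obtain ⟨R, hdeg, hrank⟩ := deg_eq_of_linear hlin
  have hI := coeff_hilbertSeries_of_linear R hdeg i
  have hini := hilbertSeries_of_isLowerSet (t := t) (initialLexSegment t v)
    (fun a ha => (mem_initialLexSegment.mp ha).1) (fun a ha b hb hab =>
      mem_initialLexSegment.mpr ⟨hb, (slexGE_of_le hab).trans (mem_initialLexSegment.mp ha).2⟩)
  have hfin := hilbertSeries_of_isUpperSet (t := t) (finalLexSegment t u)
    (fun a ha => (mem_finalLexSegment.mp ha).1) (fun a ha b hb hab =>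
      mem_finalLexSegment.mpr ⟨hb, (mem_finalLexSegment.mp ha).2.trans (slexGE_of_le hab)⟩)
  have hall := hilbertSeries_of_isLowerSet (t := t) (spreadMonomials n d t) subset_rfl
    (fun _ _ b hb _ => hb)
  -- Complete lexsegmentness, tested on single monomials.
  have hmem : ∀ s : Fin n →₀ ℕ, (∃ a ∈ lexSegment t u v, expo a ≤ s) ↔
      (∃ a ∈ initialLexSegment t v, expo a ≤ s) ∧ ∃ a ∈ finalLexSegment t u, expo a ≤ s := by
    intro s
    have h := SetLike.ext_iff.mp hcomp (MvPolynomial.monomial s 1)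
    simpa [mem_monomialIdeal, Submodule.mem_inf, MvPolynomial.support_monomial] using h
  have hcount : ∀ m, (monomialsIn (lexSegment t u v) m).card
      + (monomialsIn (spreadMonomials n d t) m).card
      = (monomialsIn (initialLexSegment t v) m).card
        + (monomialsIn (finalLexSegment t u) m).card := by
    intro m
    rw [← Finset.card_inter_add_card_union (monomialsIn (initialLexSegment t v) m)]
    congr 2
    · ext s
      simp only [Finset.mem_inter, mem_monomialsIn, hmem]
      tauto
    · ext s
      simp only [Finset.mem_union, mem_monomialsIn, ← and_or_left]
      -- A t-spread monomial is either ≥ v or < v ≤ u, so the two segments together contain all of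
      -- them.
      refine and_congr_right fun _ => ⟨?_, ?_⟩
      · rintro ⟨a, ha, hs⟩
        rcases slexGE_or_slexGT a v with h | h
        · exact Or.inl ⟨a, mem_initialLexSegment.mpr ⟨ha, h⟩, hs⟩
        · exact Or.inr ⟨a, mem_finalLexSegment.mpr ⟨ha, huv.trans (Or.inr h)⟩, hs⟩
      · rintro (⟨a, ha, hs⟩ | ⟨a, ha, hs⟩)
        · exact ⟨a, (mem_initialLexSegment.mp ha).1, hs⟩
        · exact ⟨a, (mem_finalLexSegment.mp ha).1, hs⟩
  have hsplit : spreadMonomials n d t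
      = (initialLexSegment t v).disjUnion ((finalLexSegment t v).erase v) (by
        rw [Finset.disjoint_left]
        intro a ha hb
        rw [Finset.mem_erase, mem_finalLexSegment] at hb
        exact (hb.2.2.resolve_left hb.1.symm).not_slexGE (mem_initialLexSegment.mp ha).2) := by
    ext a
    rw [Finset.mem_disjUnion, mem_initialLexSegment, Finset.mem_erase, mem_finalLexSegment]
    constructor
    · intro ha
      by_cases hav : a = v
      · exact Or.inl ⟨ha, Or.inl hav⟩
      · exact (slexGE_or_slexGT a v).imp (fun h => ⟨ha, h⟩) fun h => ⟨hav, ha, Or.inr h⟩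
    · rintro (h | h)
      · exact h.1
      · exact h.2.1
  -- Inclusion-exclusion on Hilbert series; after `hsplit` the contribution of the initial segment
  -- cancels.
  rw [show (PowerSeries.mk fun m => ((monomialsIn (lexSegment t u v) m).card : ℤ))
      = (PowerSeries.mk fun m => ((monomialsIn (initialLexSegment t v) m).card : ℤ))
        + (PowerSeries.mk fun m => ((monomialsIn (finalLexSegment t u) m).card : ℤ))
        - (PowerSeries.mk fun m => ((monomialsIn (spreadMonomials n d t) m).card : ℤ)) by
      ext m
      simp only [map_add, map_sub, PowerSeries.coeff_mk]
      have := hcount m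
      omega, sub_mul, add_mul, hini, hfin, hall, ← mul_add, ← mul_sub,
    PowerSeries.coeff_X_pow_mul, hsplit, Finset.sum_disjUnion, add_sub_add_left_eq_sub] at hI
  simp only [map_sub, map_sum, coeff_one_sub_X_pow, ← Finset.mul_sum, ← mul_sub] at hI
  -- The sign (-1)^i occurs on both sides, from the Euler characteristic and from the expansion of
  -- the powers of 1 - X.
  rw [hrank, ← mul_left_cancel₀ (pow_ne_zero i (by norm_num)) hI]
  congr 1
  · refine Finset.sum_congr rfl fun a ha => ?_
    rw [card_gaps_revSeq_eq_minIndex hd (mem_finalLexSegment.mp ha).1]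
  · refine Finset.sum_congr rfl fun a ha => ?_
    rw [card_gaps_eq_maxIndex hd (mem_finalLexSegment.mp (Finset.mem_of_mem_erase ha)).1]
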